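/- Let $K$ be a field, let $n\ge 2$ and $t\ge 1$ be integers, let $R=K[x_1,\dots,x_n]$ and $\mathfrak m=(x_1,\dots,x_n)$, and let $M_{n,t}\subset R$ be the ideal generated by the $n$ monomials $x_1^t\cdots x_{i-1}^t x_{i+1}^t\cdots x_n^t$, $i=1,\dots,n$. For an ideal $I$ of $R$ let $\operatorname{Ass}(I)$ denote the set of associated primes of $R/I$, and let $\operatorname{depth} R/I$ denote the supremum of the lengths of $R/I$-regular sequences of elements of $\mathfrak m$. Let $\operatorname{astab}(I)$ (the index of Ass-stability) be the least integer $s\ge 1$ such that $\operatorname{Ass}(I^k)=\operatorname{Ass}(I^s)$ for all $k\ge s$, and let $\operatorname{dstab}(I)$ (the index of depth stability) be the least integer $s\ge 1$ such that $\operatorname{depth} R/I^k=\operatorname{depth} R/I^s$ for all $k\ge s$. Then $$\operatorname{astab}(M_{n,t})=\operatorname{dstab}(M_{n,t})=n-1.$$ -/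

import Mathlib

/-- The monomial ideal `M_{n,t}` of `K[x_1, …, x_n]`, generated by the `n` monomials
`x_1 ^ t ⋯ x_{i-1} ^ t * x_{i+1} ^ t ⋯ x_n ^ t`, one for each `i`. -/
noncomputable def idealM (K : Type*) [Field K] (n t : ℕ) : Ideal (MvPolynomial (Fin n) K) :=
  Ideal.span (Set.range fun i : Fin n =>
    ∏ j ∈ Finset.univ.erase i, (MvPolynomial.X j : MvPolynomial (Fin n) K) ^ t)

/-- The maximal ideal `(x_1, …, x_n)` of `K[x_1, …, x_n]`. -/
noncomputable def varsIdeal (K : Type*) [Field K] (n : ℕ) : Ideal (MvPolynomial (Fin n) K) :=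
  Ideal.span (Set.range MvPolynomial.X)

/-- The set of associated primes `Ass(I)` of the module `R / I`. -/
def assPrimes {K : Type*} [Field K] {n : ℕ} (I : Ideal (MvPolynomial (Fin n) K)) :
    Set (Ideal (MvPolynomial (Fin n) K)) :=
  associatedPrimes (MvPolynomial (Fin n) K) (MvPolynomial (Fin n) K ⧸ I)

/-- The depth of `R / I` for `R = K[x_1, …, x_n]`: the supremum of the lengths of the
`R / I`-regular sequences consisting of elements of the maximal ideal `(x_1, …, x_n)`. -/
noncomputable def depthQuot {K : Type*} [Field K] {n : ℕ}
    (I : Ideal (MvPolynomial (Fin n) K)) : ℕ∞ :=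
  ⨆ rs : {rs : List (MvPolynomial (Fin n) K) // (∀ r ∈ rs, r ∈ varsIdeal K n) ∧
    RingTheory.Sequence.IsRegular (MvPolynomial (Fin n) K ⧸ I) rs}, (rs.1.length : ℕ∞)

/-- `s` is the index of Ass-stability of `I`: the least positive integer `s` such that
`Ass(I ^ k) = Ass(I ^ s)` for all `k ≥ s`. -/
def IsAstab {K : Type*} [Field K] {n : ℕ} (I : Ideal (MvPolynomial (Fin n) K)) (s : ℕ) : Prop :=
  IsLeast {s : ℕ | 1 ≤ s ∧ ∀ k, s ≤ k → assPrimes (I ^ k) = assPrimes (I ^ s)} s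

/-- `s` is the index of depth stability of `I`: the least positive integer `s` such that
`depth R / I ^ k = depth R / I ^ s` for all `k ≥ s`. -/
def IsDstab {K : Type*} [Field K] {n : ℕ} (I : Ideal (MvPolynomial (Fin n) K)) (s : ℕ) : Prop :=
  IsLeast {s : ℕ | 1 ≤ s ∧ ∀ k, s ≤ k → depthQuot (I ^ k) = depthQuot (I ^ s)} s

/-!
The `k`-th power of `M = M_{n,t}` is a monomial ideal with a simple membership test: writing
`q_j = ⌊u_j / t⌋`, the monomial `x ^ u` lies in `M ^ k` if and only if `∑ j, (k - q_j)⁺ ≤ k`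
(`mem_idealM_pow_iff`). Everything else is read off from this inequality.

An associated prime of a monomial ideal is generated by variables (`eq_span_X_image_of_colon`).
If it contains `M`, at least two variables are needed. Conversely, the prime generated by a set
`A` of variables with `2 ≤ |A| ≤ k + 1` is associated to `M ^ k`: choose deficits `c_j ≥ 1` on
`A`, zero elsewhere, with sum `k + 1`; the monomial with exponents `t (k - c_j) + (t - 1)` on `A`
and `t k` elsewhere just misses `M ^ k`, and multiplication by `x_j` brings it in if `j ∈ A`, while
no monomial in the variables outside `A` does (`span_X_image_mem_assPrimes`). So for `k ≥ n - 1` the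
associated primes are all the primes generated by at least two variables
(`assPrimes_idealM_pow`).

The maximal ideal `𝔪 = (x_1, …, x_n)` is associated to `M ^ k` only if `k ≥ n - 1`: a monomial
outside `M ^ k` that every variable multiplies into `M ^ k` has `(k - q_j)⁺ ≥ 1` for all `j` and
`∑ j, (k - q_j)⁺ = k + 1`, whence `n ≤ k + 1` (`varsIdeal_mem_assPrimes_iff`). Hence the
associated primes do not stabilize before `n - 1`. By prime avoidance the depth of `R / I` vanishes
exactly when `𝔪` is associated to `I` (`depthQuot_eq_zero_iff`), so the depth is zero exactly from
`k = n - 1` on, and the depth stabilizes there too.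
-/

open MvPolynomial

/-! ### Associated primes of monomial ideals -/

theorem mem_assPrimes_iff {K : Type*} [Field K] {n : ℕ} {I P : Ideal (MvPolynomial (Fin n) K)} :
    P ∈ assPrimes I ↔ P.IsPrime ∧ ∃ f, ∀ r, r ∈ P ↔ r * f ∈ I := by
  rw [assPrimes, AssociatedPrimes.mem_iff, isAssociatedPrime_iff]
  refine and_congr_right fun _ => ?_
  rw [(Ideal.Quotient.mk_surjective (I := I)).exists]
  refine exists_congr fun f => ?_
  rw [SetLike.ext_iff]
  refine forall_congr' fun r => ?_
  rw [Submodule.mem_colon_singleton, Submodule.mem_bot,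
    ← Ideal.Quotient.eq_zero_iff_mem (a := r * f), map_mul]
  rfl

theorem isPrime_span_X_image {σ K : Type*} [Field K] (A : Set σ) :
    (Ideal.span (X '' A : Set (MvPolynomial σ K))).IsPrime := by
  classical
  let φ : MvPolynomial σ K →ₐ[K] MvPolynomial σ K := aeval fun i => if i ∈ A then 0 else X i
  have hφ : RingHom.ker φ = Ideal.span (X '' A) := by
    apply le_antisymm
    · intro f hf
      have key : (Ideal.Quotient.mkₐ K (Ideal.span (X '' A : Set (MvPolynomial σ K)))).comp φ =
          Ideal.Quotient.mkₐ K _ := by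
        refine MvPolynomial.algHom_ext fun i => ?_
        by_cases hi : i ∈ A
        · have : (X i : MvPolynomial σ K) ∈ Ideal.span (X '' A) :=
            Ideal.subset_span (Set.mem_image_of_mem _ hi)
          simpa [φ, hi] using (Ideal.Quotient.eq_zero_iff_mem.2 this).symm
        · simp [φ, hi]
      have := DFunLike.congr_fun key f
      rw [AlgHom.comp_apply, (RingHom.mem_ker).1 hf, map_zero] at this
      exact Ideal.Quotient.eq_zero_iff_mem.1 this.symm
    · rw [Ideal.span_le]
      rintro _ ⟨i, hi, rfl⟩
      simp [φ, hi]
  rw [← hφ]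
  exact RingHom.ker_isPrime _

/-- A prime of the form `I : f` with `I` a monomial ideal (`S` being the set of exponents of the
monomials in `I`) is generated by the variables it contains. The witness `f` is taken with the
least number of terms. If the leading monomial `x ^ v` of some `g ∈ I : f` were not in the prime,
then `x ^ v * f` would be another witness, and its leading term, being the leading
term of `g * f` up to a scalar, would lie in `I` and could be dropped. -/
theorem eq_span_X_image_of_colon {σ K : Type*} [Field K] [LinearOrder σ] [WellFoundedGT σ]
    {I P : Ideal (MvPolynomial σ K)} {S : Set (σ →₀ ℕ)}
    (hI : ∀ f, f ∈ I ↔ ∀ u ∈ f.support, u ∈ S) (hP : P.IsPrime)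
    (h : ∃ f, ∀ r, r ∈ P ↔ r * f ∈ I) :
    P = Ideal.span (X '' {i | X i ∈ P}) := by
  classical
  obtain ⟨f, hf, hmin⟩ := exists_minimalFor_of_wellFoundedLT
    (fun f : MvPolynomial σ K => ∀ r, r ∈ P ↔ r * f ∈ I) (fun f => f.support.card) h
  have hf0 : f ≠ 0 := by
    rintro rfl
    exact hP.ne_top ((Ideal.eq_top_iff_one _).2 ((hf 1).2 (by simp)))
  let m : MonomialOrder σ := MonomialOrder.lex
  -- Removing the leading term shortens a polynomial.
  have card_sub : ∀ g : MvPolynomial σ K, g ≠ 0 →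
      (g - monomial (m.degree g) (g.coeff (m.degree g))).support.card < g.support.card := by
    intro g hg
    apply Finset.card_lt_card
    rw [Finset.ssubset_iff_of_subset]
    · refine ⟨m.degree g, m.degree_mem_support hg, by simp⟩
    · intro u hu
      rw [mem_support_iff, coeff_sub, coeff_monomial] at hu
      rw [mem_support_iff]
      split_ifs at hu with h
      · subst h; simp at hu
      · simpa using hu
  have lead : ∀ g ∈ P, g ≠ 0 → monomial (m.degree g) (1 : K) ∈ P := by
    intro g hg hg0
    by_contra hv
    set v := m.degree g
    set u := m.degree f
    have hS : v + u ∈ S := by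
      refine (hI _).1 ((hf g).1 hg) _ ?_
      rw [mem_support_iff, m.coeff_mul_of_degree_add]
      exact mul_ne_zero (m.leadingCoeff_ne_zero_iff.2 hg0) (m.leadingCoeff_ne_zero_iff.2 hf0)
    have hmem : monomial v (1 : K) * monomial u (f.coeff u) ∈ I := by
      rw [monomial_mul, hI]
      intro w hw
      rw [Finset.mem_singleton.1 (support_monomial_subset hw)]
      exact hS
    -- `x ^ v * f` without its leading term is a witness with fewer terms than `f`.
    have hnew : ∀ r, r ∈ P ↔ r * (monomial v (1 : K) * (f - monomial u (f.coeff u))) ∈ I := by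
      intro r
      have e : r * (monomial v (1 : K) * (f - monomial u (f.coeff u))) =
        (r * monomial v (1 : K)) * f - r * (monomial v (1 : K) * monomial u (f.coeff u)) := by ring
      rw [e, Submodule.sub_mem_iff_left _ (Ideal.mul_mem_left _ _ hmem), ← hf]
      exact ⟨fun h => Ideal.mul_mem_right _ _ h, fun h => (hP.mem_or_mem h).resolve_right hv⟩
    have hle : (monomial v (1 : K) * (f - monomial u (f.coeff u))).support.card ≤
        (f - monomial u (f.coeff u)).support.card := by
      refine (Finset.card_le_card (support_mul _ _)).trans ?_
      refine (Finset.card_add_le).trans ?_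
      calc _ ≤ 1 * _ := Nat.mul_le_mul_right _
            ((Finset.card_le_card support_monomial_subset).trans (by simp))
        _ = _ := one_mul _
    have hlt := card_sub f hf0
    exact absurd (hmin hnew (hle.trans hlt.le)) (not_le.2 (hle.trans_lt hlt))
  have all : ∀ (c : ℕ) (g : MvPolynomial σ K), g.support.card ≤ c → g ∈ P →
      ∀ u ∈ g.support, monomial u (1 : K) ∈ P := by
    intro c
    induction c with
    | zero =>
      intro g hc _ u hu
      simp [Finset.card_eq_zero.1 (Nat.le_zero.1 hc)] at hu
    | succ c ih =>
      intro g hc hg u hu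
      have hg0 : g ≠ 0 := by rintro rfl; simp at hu
      have hl := lead g hg hg0
      by_cases h : m.degree g = u
      · rwa [← h]
      refine ih (g - monomial (m.degree g) (g.coeff (m.degree g)))
        (Nat.le_of_lt_succ ((card_sub g hg0).trans_le hc)) (P.sub_mem hg ?_) u ?_
      · rw [← mul_one (coeff _ _), ← C_mul_monomial]
        exact Ideal.mul_mem_left _ _ hl
      · rw [mem_support_iff, coeff_sub, coeff_monomial, if_neg h, sub_zero]
        exact mem_support_iff.1 hu
  apply le_antisymm
  · intro g hg
    rw [mem_ideal_span_X_image]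
    intro u hu
    have hu' := all _ g le_rfl hg u hu
    rw [monomial_eq, C_1, one_mul, Finsupp.prod, hP.prod_mem_iff] at hu'
    obtain ⟨i, hi, hiP⟩ := hu'
    exact ⟨i, hP.mem_of_pow_mem _ hiP, Finsupp.mem_support_iff.1 hi⟩
  · rw [Ideal.span_le]
    rintro _ ⟨i, hi, rfl⟩
    exact hi

/-! ### Monomials in the powers of `M_{n,t}` -/

/-- The exponents `u` of the monomials `x ^ u` in the `k`-th power of `M_{n,t}`. The subtraction is
the truncated one: each `k - ⌊u_j / t⌋` is the least number of factors lacking `x_j` in a product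
of `k` generators whose exponent at `x_j` is at most `u_j`. -/
def powExponents (n t k : ℕ) : Set (Fin n →₀ ℕ) :=
  {u | ∑ j, (k - u j / t) ≤ k}

theorem powExponents_mono {n t k : ℕ} {u v : Fin n →₀ ℕ} (huv : u ≤ v)
    (hu : u ∈ powExponents n t k) : v ∈ powExponents n t k :=
  (Finset.sum_le_sum fun j _ => Nat.sub_le_sub_left (Nat.div_le_div_right (huv j)) k).trans hu

/-- The exponent of the generator of `M_{n,t}` that lacks the variable `x_i`. -/
noncomputable def genExponent {n : ℕ} (t : ℕ) (i : Fin n) : Fin n →₀ ℕ :=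
  Finsupp.equivFunOnFinite.symm fun j => if j = i then 0 else t

theorem genExponent_apply {n : ℕ} (t : ℕ) (i j : Fin n) :
    genExponent t i j = if j = i then 0 else t := rfl

theorem idealM_eq_span_monomial (K : Type*) [Field K] (n t : ℕ) :
    idealM K n t = Ideal.span ((fun u => monomial u (1 : K)) '' Set.range (genExponent t)) := by
  rw [idealM, ← Set.range_comp]
  congr 2
  ext1 i
  rw [Function.comp_apply, monomial_eq, C_1, one_mul, Finsupp.prod_fintype _ _ (by simp),
    ← Finset.mul_prod_erase _ _ (Finset.mem_univ i), genExponent_apply, if_pos rfl, pow_zero,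
    one_mul]
  refine Finset.prod_congr rfl fun j hj => ?_
  rw [genExponent_apply, if_neg (Finset.ne_of_mem_erase hj)]

theorem add_genExponent_mem_powExponents {n t k : ℕ} (ht : 1 ≤ t) {u : Fin n →₀ ℕ}
    (hu : u ∈ powExponents n t k) (i : Fin n) :
    u + genExponent t i ∈ powExponents n t (k + 1) := by
  have key : ∀ j ∈ Finset.univ, k + 1 - (u + genExponent t i) j / t ≤
      (k - u j / t) + if j = i then 1 else 0 := by
    intro j _
    rw [Finsupp.add_apply, genExponent_apply]
    split_ifs
    · rw [add_zero]; omega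
    · rw [Nat.add_div_right _ ht]; omega
  refine (Finset.sum_le_sum key).trans ?_
  rw [Finset.sum_add_distrib, Finset.sum_ite_eq' Finset.univ i, if_pos (Finset.mem_univ i)]
  exact Nat.add_le_add_right hu 1

/-- A monomial satisfying the inequality for `k + 1` is divisible by a generator with quotient
satisfying it for `k`; the generator to split off is one lacking a variable `x_i` with
`⌊u_i / t⌋ = 0`, or else with `⌊u_i / t⌋ ≤ k`, or else any generator. -/
theorem exists_eq_add_genExponent {n t k : ℕ} (hn : 1 ≤ n) {u : Fin n →₀ ℕ}
    (hu : u ∈ powExponents n t (k + 1)) :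
    ∃ i, ∃ v ∈ powExponents n t k, u = v + genExponent t i := by
  have hu' : ∑ j, (k + 1 - u j / t) ≤ k + 1 := hu
  obtain ⟨i, hi, hsum⟩ : ∃ i, (∀ j ≠ i, t ≤ u j) ∧
      (k - u i / t) + ∑ j ∈ Finset.univ.erase i, (k + 1 - u j / t) ≤ k := by
    have split := fun i => Finset.add_sum_erase Finset.univ (fun j => k + 1 - u j / t)
      (Finset.mem_univ i)
    by_cases h0 : ∃ i, u i < t
    · obtain ⟨i, hi⟩ := h0
      have h := split i
      rw [Nat.div_eq_of_lt hi] at h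
      -- The summand at `i` is already `k + 1`, so all the others vanish.
      have h0 : ∑ j ∈ Finset.univ.erase i, (k + 1 - u j / t) = 0 := by omega
      refine ⟨i, fun j hj => ?_, by rw [h0, add_zero]; exact Nat.sub_le _ _⟩
      have := Finset.sum_eq_zero_iff.1 h0 j (by simp [hj])
      by_contra hlt
      rw [Nat.div_eq_of_lt (not_le.1 hlt)] at this
      omega
    · push Not at h0
      by_cases h1 : ∃ i, 0 < k + 1 - u i / t
      · obtain ⟨i, hi⟩ := h1
        have h := split i
        exact ⟨i, fun j _ => h0 j, by omega⟩
      · push Not at h1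
        refine ⟨⟨0, hn⟩, fun j _ => h0 j, ?_⟩
        rw [Finset.sum_eq_zero fun j _ => Nat.le_zero.1 (h1 j), add_zero]
        exact Nat.sub_le _ _
  have hle : genExponent t i ≤ u := by
    intro j
    rw [genExponent_apply]
    split_ifs with h
    · exact Nat.zero_le _
    · exact hi j h
  refine ⟨i, u - genExponent t i, ?_, (tsub_add_cancel_of_le hle).symm⟩
  change ∑ j, (k - (u - genExponent t i) j / t) ≤ k
  rw [← Finset.add_sum_erase _ _ (Finset.mem_univ i)]
  refine le_trans (Nat.add_le_add ?_ (Finset.sum_le_sum ?_)) hsum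
  · simp [genExponent_apply]
  · intro j hj
    rw [Finsupp.tsub_apply, genExponent_apply, if_neg (Finset.ne_of_mem_erase hj),
      show u j - t = u j - t * 1 by rw [mul_one], Nat.sub_mul_div]
    omega

theorem idealM_pow_eq_span (K : Type*) [Field K] {n t : ℕ} (hn : 1 ≤ n) (ht : 1 ≤ t) (k : ℕ) :
    idealM K n t ^ k = Ideal.span ((fun u => monomial u (1 : K)) '' powExponents n t k) := by
  induction k with
  | zero =>
    rw [pow_zero, Ideal.one_eq_top, eq_comm, Ideal.eq_top_iff_one]
    exact Ideal.subset_span ⟨0, by simp [powExponents], rfl⟩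
  | succ k ih =>
    rw [pow_succ, ih, idealM_eq_span_monomial, Ideal.span_mul_span']
    congr 1
    ext f
    simp only [Set.mem_mul, Set.mem_image, Set.mem_range]
    constructor
    · rintro ⟨_, ⟨u, hu, rfl⟩, _, ⟨_, ⟨i, rfl⟩, rfl⟩, rfl⟩
      exact ⟨_, add_genExponent_mem_powExponents ht hu i, by simp [monomial_mul]⟩
    · rintro ⟨u, hu, rfl⟩
      obtain ⟨i, v, hv, rfl⟩ := exists_eq_add_genExponent hn hu
      exact ⟨_, ⟨v, hv, rfl⟩, _, ⟨_, ⟨i, rfl⟩, rfl⟩, by simp [monomial_mul]⟩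

theorem mem_idealM_pow_iff {K : Type*} [Field K] {n t : ℕ} (hn : 1 ≤ n) (ht : 1 ≤ t) {k : ℕ}
    (f : MvPolynomial (Fin n) K) :
    f ∈ idealM K n t ^ k ↔ ∀ u ∈ f.support, u ∈ powExponents n t k := by
  rw [idealM_pow_eq_span K hn ht, mem_ideal_span_monomial_image]
  exact forall₂_congr fun u _ => ⟨fun ⟨_, hv, hvu⟩ => powExponents_mono hvu hv,
    fun hu => ⟨u, hu, le_rfl⟩⟩

/-! ### Associated primes of the powers of `M_{n,t}` -/

theorem span_X_image_mem_assPrimes {K : Type*} [Field K] {n t k : ℕ} (ht : 1 ≤ t)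
    {A : Finset (Fin n)} (hA : 2 ≤ A.card) (hk : A.card ≤ k + 1) :
    Ideal.span (X '' (A : Set (Fin n))) ∈ assPrimes (idealM K n t ^ k) := by
  have hn : 1 ≤ n := by
    have := A.card_le_univ
    simp at this
    omega
  obtain ⟨a, ha⟩ := Finset.card_pos.1 (two_pos.trans_le hA)
  -- The deficits `c j` are positive exactly on `A` and sum to `k + 1`. Having two elements in `A`
  -- keeps each of them at most `k`.
  let c : Fin n → ℕ := fun j => if j ∈ A then (if j = a then k + 2 - A.card else 1) else 0
  have hcle : ∀ j, c j ≤ k := by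
    intro j; simp only [c]; split_ifs <;> omega
  have hcpos : ∀ j ∈ A, 1 ≤ c j := by
    intro j hj; simp only [c, hj, if_true]; split_ifs <;> omega
  have hcsum : ∑ j, c j = k + 1 := by
    rw [Finset.sum_ite_mem, Finset.univ_inter, ← Finset.add_sum_erase A _ ha, if_pos rfl,
      Finset.sum_congr rfl (fun j hj => if_neg (Finset.ne_of_mem_erase hj)), Finset.sum_const,
      Finset.card_erase_of_mem ha]
    simp
    omega
  -- The prime generated by `A` will be the colon of `M ^ k` by the monomial `x ^ u`.
  let u : Fin n →₀ ℕ := Finsupp.equivFunOnFinite.symm fun j =>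
    t * (k - c j) + if j ∈ A then t - 1 else 0
  have hu : ∀ j, u j = t * (k - c j) + if j ∈ A then t - 1 else 0 := fun _ => rfl
  have hdiv : ∀ j, u j / t = k - c j := by
    intro j
    rw [hu, Nat.mul_add_div ht, Nat.div_eq_of_lt (by split_ifs <;> omega), add_zero]
  have hq : ∀ v : Fin n →₀ ℕ, v + u ∈ powExponents n t k ↔ ∃ j ∈ (A : Set (Fin n)), v j ≠ 0 := by
    intro v
    constructor
    · intro hv
      by_contra! hv0
      have : ∀ j, k - (v + u) j / t = c j := by
        intro j
        by_cases hj : j ∈ A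
        · rw [Finsupp.add_apply, hv0 j hj, zero_add, hdiv]
          have := hcle j
          omega
        · have h1 : c j = 0 := by simp [c, hj]
          have h2 : u j / t ≤ (v + u) j / t := Nat.div_le_div_right (by simp)
          rw [hdiv] at h2
          omega
      have hv' : ∑ j, (k - (v + u) j / t) ≤ k := hv
      simp only [this, hcsum] at hv'
      omega
    · rintro ⟨i, hi, hvi⟩
      change ∑ j, (k - (v + u) j / t) ≤ k
      refine Nat.le_of_lt_succ ?_
      rw [Nat.succ_eq_add_one, ← hcsum]
      have hle : ∀ j, k - (v + u) j / t ≤ c j := by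
        intro j
        have h2 : u j / t ≤ (v + u) j / t := Nat.div_le_div_right (by simp)
        rw [hdiv] at h2
        omega
      refine Finset.sum_lt_sum (fun j _ => hle j) ⟨i, Finset.mem_univ i, ?_⟩
      have h1 := hcpos i hi
      have h2 : k - c i + 1 ≤ (v + u) i / t := by
        rw [Nat.le_div_iff_mul_le ht, Finsupp.add_apply, hu, if_pos (Finset.mem_coe.1 hi),
          add_mul, one_mul, mul_comm t]
        omega
      omega
  refine mem_assPrimes_iff.2 ⟨isPrime_span_X_image _, monomial u 1, fun r => ?_⟩
  rw [mem_ideal_span_X_image, mem_idealM_pow_iff hn ht]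
  constructor
  · intro h w hw
    rw [mem_support_iff, coeff_mul_monomial'] at hw
    split_ifs at hw with huw
    · rw [← tsub_add_cancel_of_le huw, hq]
      exact h _ (mem_support_iff.2 (by simpa using hw))
    · exact absurd rfl hw
  · intro h v hv
    refine (hq v).1 (h _ ?_)
    rw [mem_support_iff, coeff_mul_monomial, mul_one]
    exact mem_support_iff.1 hv

theorem eq_span_X_image_of_mem_assPrimes {K : Type*} [Field K] {n t k : ℕ} (hn : 2 ≤ n)
    (ht : 1 ≤ t) {P : Ideal (MvPolynomial (Fin n) K)} (hP : P ∈ assPrimes (idealM K n t ^ k)) :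
    ∃ A : Finset (Fin n), 2 ≤ A.card ∧ P = Ideal.span (X '' (A : Set (Fin n))) := by
  classical
  obtain ⟨hprime, hf⟩ := mem_assPrimes_iff.1 hP
  refine ⟨Finset.univ.filter fun i => X i ∈ P, ?_, ?_⟩
  · have hMP : idealM K n t ≤ P := by
      obtain ⟨f, hf⟩ := hf
      intro g hg
      exact hprime.mem_of_pow_mem k ((hf _).2 (Ideal.mul_mem_right _ _ (Ideal.pow_mem_pow hg k)))
    have hex : ∀ i, ∃ j ≠ i, X j ∈ P := by
      intro i
      have := hMP (Ideal.subset_span ⟨i, rfl⟩)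
      rw [hprime.prod_mem_iff] at this
      obtain ⟨j, hj, hjP⟩ := this
      exact ⟨j, Finset.ne_of_mem_erase hj, hprime.mem_of_pow_mem _ hjP⟩
    obtain ⟨a, -, ha⟩ := hex ⟨0, by omega⟩
    obtain ⟨b, hba, hb⟩ := hex a
    exact Finset.one_lt_card_iff.2 ⟨a, b, by simpa using ha, by simpa using hb, hba.symm⟩
  · rw [Finset.coe_filter]
    simpa using eq_span_X_image_of_colon (mem_idealM_pow_iff (by omega) ht) hprime hf

theorem assPrimes_idealM_pow {K : Type*} [Field K] {n t k : ℕ} (hn : 2 ≤ n) (ht : 1 ≤ t)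
    (hk : n - 1 ≤ k) :
    assPrimes (idealM K n t ^ k) =
      {P | ∃ A : Finset (Fin n), 2 ≤ A.card ∧ P = Ideal.span (X '' (A : Set (Fin n)))} := by
  ext P
  refine ⟨eq_span_X_image_of_mem_assPrimes hn ht, ?_⟩
  rintro ⟨A, hA, rfl⟩
  refine span_X_image_mem_assPrimes ht hA ?_
  have := A.card_le_univ
  simp at this
  omega

theorem varsIdeal_eq_span_image (K : Type*) [Field K] (n : ℕ) :
    varsIdeal K n = Ideal.span (X '' ((Finset.univ : Finset (Fin n)) : Set (Fin n))) := by
  simp [varsIdeal]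

theorem varsIdeal_mem_assPrimes_iff {K : Type*} [Field K] {n t k : ℕ} (hn : 2 ≤ n) (ht : 1 ≤ t) :
    varsIdeal K n ∈ assPrimes (idealM K n t ^ k) ↔ n - 1 ≤ k := by
  constructor
  · intro h
    obtain ⟨hprime, f, hf⟩ := mem_assPrimes_iff.1 h
    have hfI : f ∉ idealM K n t ^ k := fun hfI =>
      hprime.ne_top ((Ideal.eq_top_iff_one _).2 ((hf 1).2 (by simpa using hfI)))
    rw [mem_idealM_pow_iff (by omega) ht] at hfI
    push Not at hfI
    -- A term of `f` outside `M ^ k`: each variable multiplies it into `M ^ k`.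
    obtain ⟨u, hu, huS⟩ := hfI
    have hstep : ∀ i, Finsupp.single i 1 + u ∈ powExponents n t k := by
      intro i
      refine (mem_idealM_pow_iff (by omega) ht _).1 ((hf (X i)).1 (Ideal.subset_span ⟨i, rfl⟩)) _ ?_
      rw [mem_support_iff, mul_comm, add_comm, coeff_mul_X]
      exact mem_support_iff.1 hu
    have hu' : k < ∑ j, (k - u j / t) := not_le.1 huS
    -- Raising `u i` by one lowers only the `i`-th summand, by at most one, and the sum must drop.
    have hval : ∀ i, ∑ j, (k - u j / t) ≤ k + 1 ∧ 1 ≤ k - u i / t := by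
      intro i
      have h1 : ∑ j, (k - (Finsupp.single i 1 + u : Fin n →₀ ℕ) j / t) ≤ k := hstep i
      rw [← Finset.add_sum_erase _ _ (Finset.mem_univ i)] at h1 hu' ⊢
      have h2 : ∑ j ∈ Finset.univ.erase i, (k - (Finsupp.single i 1 + u : Fin n →₀ ℕ) j / t) =
          ∑ j ∈ Finset.univ.erase i, (k - u j / t) :=
        Finset.sum_congr rfl fun j hj => by
          simp [Finsupp.single_eq_of_ne (Finset.ne_of_mem_erase hj)]
      have h3 : (Finsupp.single i 1 + u : Fin n →₀ ℕ) i / t ≤ u i / t + 1 := by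
        rw [← Nat.add_div_right _ ht, Finsupp.add_apply, Finsupp.single_eq_same]
        exact Nat.div_le_div_right (by omega)
      omega
    have hcard : ∑ _j : Fin n, 1 ≤ ∑ j, (k - u j / t) :=
      Finset.sum_le_sum fun j _ => (hval j).2
    have := (hval ⟨0, by omega⟩).1
    simp at hcard
    omega
  · intro hk
    rw [varsIdeal_eq_span_image]
    exact span_X_image_mem_assPrimes ht (by simpa using hn) (by simp; omega)

/-! ### Depth zero -/

theorem varsIdeal_isMaximal (K : Type*) [Field K] (n : ℕ) : (varsIdeal K n).IsMaximal := by
  have h : varsIdeal K n = RingHom.ker (constantCoeff : MvPolynomial (Fin n) K →+* K) := by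
    ext f
    rw [varsIdeal_eq_span_image, mem_ideal_span_X_image, RingHom.mem_ker, constantCoeff_eq,
      ← notMem_support_iff]
    constructor
    · intro h h0
      obtain ⟨i, -, hi⟩ := h 0 h0
      exact hi rfl
    · intro h u hu
      obtain ⟨i, hi⟩ := Finsupp.ne_iff.1 (ne_of_mem_of_not_mem hu h)
      exact ⟨i, by simp, hi⟩
  rw [h]
  exact RingHom.ker_isMaximal_of_surjective _ fun c => ⟨C c, constantCoeff_C _ c⟩

/-- If the maximal ideal is not associated to `I`, prime avoidance yields an element of it outside
every associated prime, which is a regular sequence of length one. -/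
theorem depthQuot_eq_zero_iff {K : Type*} [Field K] {n : ℕ} {I : Ideal (MvPolynomial (Fin n) K)}
    (hI : I ≤ varsIdeal K n) : depthQuot I = 0 ↔ varsIdeal K n ∈ assPrimes I := by
  have hmax := varsIdeal_isMaximal K n
  have hzd := biUnion_associatedPrimes_eq_zero_divisors
    (MvPolynomial (Fin n) K) (MvPolynomial (Fin n) K ⧸ I)
  constructor
  · intro hdepth
    by_contra hmem
    have hfin : (assPrimes I).Finite := associatedPrimes.finite _ _
    obtain ⟨r, hr, hrP⟩ : ∃ r ∈ varsIdeal K n, ∀ P ∈ assPrimes I, r ∉ P := by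
      by_contra! hcon
      have hsub : (varsIdeal K n : Set (MvPolynomial (Fin n) K)) ⊆
          ⋃ P ∈ (hfin.toFinset : Set (Ideal (MvPolynomial (Fin n) K))), (P : Set _) := by
        intro r hr
        obtain ⟨P, hP, hrP⟩ := hcon r hr
        exact Set.mem_biUnion (by simpa using hP) hrP
      obtain ⟨P, hP, hle⟩ := (Ideal.subset_union_prime (f := id) ⊤ ⊤
        fun P hP _ _ => ((hfin.mem_toFinset.1 hP : P ∈ assPrimes I)).isPrime).1 hsub
      have hPA : P ∈ assPrimes I := hfin.mem_toFinset.1 hP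
      rw [← hmax.eq_of_le hPA.isPrime.ne_top hle] at hPA
      exact hmem hPA
    have hreg : RingTheory.Sequence.IsRegular (MvPolynomial (Fin n) K ⧸ I) [r] := by
      refine ⟨(RingTheory.Sequence.isWeaklyRegular_singleton_iff _ _).2 ?_, ?_⟩
      · rw [isSMulRegular_iff_right_eq_zero_of_smul]
        intro x hx
        by_contra hx0
        have : r ∈ ⋃ p ∈ associatedPrimes (MvPolynomial (Fin n) K) (MvPolynomial (Fin n) K ⧸ I),
            (p : Set (MvPolynomial (Fin n) K)) := hzd ▸ ⟨x, hx0, hx⟩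
        obtain ⟨P, hP, hrP'⟩ := Set.mem_iUnion₂.1 this
        exact hrP P hP hrP'
      · intro htop
        have hle : Ideal.ofList [r] • (⊤ : Submodule (MvPolynomial (Fin n) K)
            (MvPolynomial (Fin n) K ⧸ I)) ≤ Submodule.map (Submodule.mkQ I) (varsIdeal K n) := by
          rw [Ideal.ofList_singleton, Submodule.smul_le]
          intro a ha x _
          obtain ⟨y, rfl⟩ := Submodule.mkQ_surjective I x
          rw [← map_smul]
          refine Submodule.mem_map_of_mem (Ideal.mul_mem_right _ _ ?_)
          exact (Ideal.span_singleton_le_iff_mem _).2 hr ha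
        rw [← htop] at hle
        obtain ⟨y, hy, hy1⟩ := hle (Submodule.mem_top (x := Submodule.mkQ I 1))
        have hsub := hI ((Submodule.Quotient.eq I).1 hy1)
        exact hmax.ne_top ((Ideal.eq_top_iff_one _).2 ((Submodule.sub_mem_iff_right _ hy).1 hsub))
    have hle : (1 : ℕ∞) ≤ depthQuot I := by
      refine le_iSup_of_le ⟨[r], by simpa using hr, hreg⟩ ?_
      simp
    rw [hdepth] at hle
    simp at hle
  · intro h
    rw [depthQuot, ENat.iSup_eq_zero]
    rintro ⟨rs, hrs, hreg⟩
    cases rs with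
    | nil => rfl
    | cons r rs =>
      exfalso
      have hr : r ∈ {r : MvPolynomial (Fin n) K |
          ∃ x : MvPolynomial (Fin n) K ⧸ I, x ≠ 0 ∧ r • x = 0} :=
        hzd ▸ Set.mem_biUnion h (hrs r (by simp))
      obtain ⟨x, hx0, hx⟩ := hr
      have hr' := ((RingTheory.Sequence.isRegular_cons_iff _ _ _).1 hreg).1
      exact hx0 (hr'.right_eq_zero_of_smul hx)

/-! ### Stability indices -/

theorem idealM_pow_le_varsIdeal {K : Type*} [Field K] {n t k : ℕ} (hn : 2 ≤ n) (ht : 1 ≤ t)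
    (hk : 1 ≤ k) : idealM K n t ^ k ≤ varsIdeal K n := by
  refine (Ideal.pow_le_self (by omega)).trans (Ideal.span_le.2 ?_)
  rintro _ ⟨i, rfl⟩
  have : Nontrivial (Fin n) := Fin.nontrivial_iff_two_le.2 hn
  obtain ⟨j, hj⟩ := exists_ne i
  refine Ideal.mem_of_dvd _ (Finset.dvd_prod_of_mem (fun j => (X j : MvPolynomial (Fin n) K) ^ t)
    (Finset.mem_erase.2 ⟨hj, Finset.mem_univ j⟩)) ?_
  have hX : (X j : MvPolynomial (Fin n) K) ∈ varsIdeal K n := Ideal.subset_span ⟨j, rfl⟩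
  exact Ideal.pow_mem_of_mem _ hX _ ht

theorem theorem1p7 (K : Type*) [Field K] (n t : ℕ) (hn : 2 ≤ n) (ht : 1 ≤ t) :
    IsAstab (idealM K n t) (n - 1) ∧ IsDstab (idealM K n t) (n - 1) := by
  refine ⟨⟨⟨by omega, fun k hk => ?_⟩, fun s ⟨hs, hstab⟩ => ?_⟩,
    ⟨⟨by omega, fun k hk => ?_⟩, fun s ⟨hs, hstab⟩ => ?_⟩⟩
  · rw [assPrimes_idealM_pow hn ht hk, assPrimes_idealM_pow hn ht le_rfl]
  · by_contra hlt
    have h := hstab (n - 1) (by omega)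
    have hm := (varsIdeal_mem_assPrimes_iff (K := K) hn ht).2 (le_refl (n - 1))
    rw [h] at hm
    exact hlt ((varsIdeal_mem_assPrimes_iff hn ht).1 hm)
  · have hzero : ∀ k, n - 1 ≤ k → depthQuot (idealM K n t ^ k) = 0 := fun k hk =>
      (depthQuot_eq_zero_iff (idealM_pow_le_varsIdeal hn ht (by omega))).2
        ((varsIdeal_mem_assPrimes_iff hn ht).2 hk)
    rw [hzero k hk, hzero _ le_rfl]
  · by_contra hlt
    have h := hstab (n - 1) (by omega)
    rw [(depthQuot_eq_zero_iff (idealM_pow_le_varsIdeal hn ht (by omega))).2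
      ((varsIdeal_mem_assPrimes_iff hn ht).2 le_rfl), eq_comm,
      depthQuot_eq_zero_iff (idealM_pow_le_varsIdeal hn ht hs)] at h
    exact hlt ((varsIdeal_mem_assPrimes_iff hn ht).1 h)
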